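/- Conventions. A dcpo is a partially ordered set $(D,\sqsubseteq)$ in which every nonempty directed subset has a least upper bound; it carries the Scott topology (open sets: upsets $O$ such that every nonempty directed set with supremum in $O$ meets $O$). We write $x\ll y$ if every nonempty directed set $S$ with $y\sqsubseteq\bigsqcup S$ has an element $s$ with $x\sqsubseteq s$. A set $B\subseteq D$ is a basis of $D$ (and $D$ is then a continuous domain) if for every $x\in D$ the set $\{b\in B : b\ll x\}$ is nonempty, directed and has supremum $x$. A set is $\mathbf{\Sigma}^0_2(D)$ if it is a countable union of Boolean combinations of open sets, and $\mathbf{\Delta}^0_2(D)$ if both it and its complement are $\mathbf{\Sigma}^0_2(D)$. For an ordinal $\alpha$, $\mathbf{D}_\alpha(D)$ is the class of all sets $$\bigcup_{\beta<\alpha,\ \beta\not\sim\alpha}\Bigl(A_\beta\setminus\bigcup_{\gamma<\beta}A_\gamma\Bigr)$$ with $(A_\beta)_{\beta<\alpha}$ a sequence of open sets, where $\beta\sim\alpha$ means that $\beta$ and $\alpha$ have the same parity ($0$ and limit ordinals being even). A tree is a nonempty set $T$ of finite sequences (over an arbitrary set) closed under prefixes; a son of $\tau\in T$ is an element of $T$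 extending $\tau$ by one entry. If $T$ has no infinite branch, the rank of a node is the supremum of $\mathrm{rank}(\sigma)+1$ over its sons $\sigma$ ($0$ for leaves), and the rank of $T$ is that of its root. For $B\subseteq D$, a $B$-tree is a map $f:T\to B$ with $T$ a tree; it has rank $\alpha$ if $T$ has no infinite branch and has rank $\alpha$. For $A\subseteq D$ it is $(A,1)$-alternating if $f(\mathrm{nil})\in A$ and, whenever $\sigma$ is a son of $\tau$, $f(\sigma)\in A\Leftrightarrow f(\tau)\notin A$. For $\preceq$ equal to $\sqsubseteq$ or $\ll$ it is $\preceq$-increasing if $f(\tau)\preceq f(\sigma)$ whenever $\sigma$ is a son of $\tau$. Theorem. Let $(D,\sqsubseteq)$ be a dcpo, $B\subseteq D$, $A\in\mathbf{\Delta}^0_2(D)$ and $0<\alpha<\aleph_1$ (that is, $\alpha$ is a nonzero countable ordinal). 1. If $A\in\mathbf{D}_\alpha(D)$, then there is no $\sqsubseteq$-increasing $(A,1)$-alternating $B$-tree of rank $\alpha$. 2. If $D$ is a continuous domain with basis $B$, the following are equivalent: (i) $A\in\mathbf{D}_\alpha(D)$; (ii) there is no $\sqsubseteq$-increasing $(A,1)$-alternating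 $B$-tree of rank $\alpha$; (iii) there is no $\ll$-increasing $(A,1)$-alternating $B$-tree of rank $\alpha$. -/

import Mathlib

universe u

namespace DomainHierarchy

/-! ### Trees of finite sequences, their ranks, and alternating trees -/

section Trees

variable {X : Type u}

/-- `σ` is a son of `τ` in the tree `T`: `σ` extends `τ` by exactly one entry. -/
def IsSon (T : Descriptive.tree X) (σ τ : T) : Prop :=
  ∃ x : X, (σ : List X) = (τ : List X) ++ [x]

/-- The tree `T` has no infinite branch: there is no infinite sequence all of whose finite
initial segments belong to `T`. -/
def IsWellFoundedTree (T : Descriptive.tree X) : Prop :=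
  ¬ ∃ b : ℕ → X, ∀ n : ℕ, (List.range n).map b ∈ T

/-- In a tree without infinite branch, "being a son of" is a well-founded relation. -/
theorem IsWellFoundedTree.wellFounded {T : Descriptive.tree X} (hT : IsWellFoundedTree T) :
    WellFounded (IsSon T) := by
  rw [wellFounded_iff_isEmpty_descending_chain]
  refine ⟨fun ⟨s, hs⟩ => hT ?_⟩
  choose x hx using hs
  have key : ∀ n, (s n : List X) = (s 0 : List X) ++ (List.range n).map x := by
    intro n
    induction n with
    | zero => simp
    | succ n ih => rw [hx, ih, List.range_succ]; simp
  obtain ⟨l, hl⟩ : ∃ l : List X, l = (s 0 : List X) := ⟨_, rfl⟩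
  refine ⟨fun n => if h : n < l.length then l[n] else x (n - l.length), fun n => ?_⟩
  refine Descriptive.Tree.mem_of_prefix (y := (s n : List X)) ?_ (s n).2
  rw [key, ← hl, List.prefix_iff_eq_take]
  refine List.ext_getElem (by simp) fun i h1 h2 => ?_
  simp only [List.length_map, List.length_range] at h1
  simp [List.getElem_append]

/-- The rank of a node of a well-founded tree: the supremum of `rank τ + 1` over the sons `τ` of
the node, and `0` on leaves. -/
noncomputable def nodeRank {T : Descriptive.tree X} (hT : IsWellFoundedTree T) (σ : T) :
    Ordinal.{u} :=
  (hT.wellFounded.apply σ).rank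

/-- `g : T → {0,1}` is `ε`-alternating: it takes different values at a node and at any of its
sons, and its value at the root is `ε`. -/
def IsAlternating {T : Descriptive.tree X} (hT : [] ∈ T) (g : T → Fin 2) (ε : Fin 2) : Prop :=
  (∀ σ τ : T, IsSon T σ τ → g σ ≠ g τ) ∧ g ⟨[], hT⟩ = ε

end Trees

/-- A `B`-tree: a map to `B` from a nonempty set of finite sequences (over an arbitrary set `X`)
that is closed under prefixes. -/
structure BTree {D : Type u} (B : Set D) where
  /-- the entries of the sequences -/
  X : Type u
  /-- the underlying tree -/
  T : Descriptive.tree X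
  nil_mem : [] ∈ T
  /-- the labelling of the nodes -/
  f : T → B

namespace BTree

variable {D : Type u} {B : Set D}

/-- The characteristic function of `A`, with values in `{0,1}`. -/
noncomputable def chi (A : Set D) : D → Fin 2 := A.indicator 1

/-- The `B`-tree `t` is `(A,ε)`-alternating: `χ_A ∘ f` is `ε`-alternating. -/
def Alternates (t : BTree B) (A : Set D) (ε : Fin 2) : Prop :=
  IsAlternating t.nil_mem (fun σ => chi A (t.f σ : D)) ε

/-- The `B`-tree `t` is increasing for the relation `r`: labels go up from a node to its sons. -/
def Increasing (t : BTree B) (r : D → D → Prop) : Prop :=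
  ∀ σ τ : t.T, IsSon t.T σ τ → r (t.f τ : D) (t.f σ : D)

/-- The `B`-tree `t` is well-founded and its root has rank `α`. -/
def HasRank (t : BTree B) (α : Ordinal.{u}) : Prop :=
  ∃ h : IsWellFoundedTree t.T, nodeRank h ⟨[], t.nil_mem⟩ = α

end BTree

/-! ### The classes `Σ⁰₂`, `Δ⁰₂` and the difference hierarchy -/

section Classes

variable {E : Type u} [TopologicalSpace E]

/-- `Σ⁰₂` sets of a topological space: countable unions of Boolean combinations of open sets. -/
def IsSigma02 (A : Set E) : Prop :=
  ∃ F : ℕ → Set E,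
    (∀ n, F n ∈ BooleanSubalgebra.closure {U : Set E | IsOpen U}) ∧ A = ⋃ n, F n

/-- `Δ⁰₂` sets: the set and its complement are both `Σ⁰₂`. -/
def IsDelta02 (A : Set E) : Prop :=
  IsSigma02 A ∧ IsSigma02 Aᶜ

/-- Two ordinals have the same parity. Every ordinal is uniquely `2 * q + r` with `r < 2`; for
`λ + n` with `λ` zero or limit and `n` finite, `r` is the remainder of `n` modulo `2`. -/
def SameParity (α β : Ordinal.{u}) : Prop := α % 2 = β % 2

/-- The difference operation applied to a sequence of sets indexed by the ordinals `< α`. -/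
def diffOp (α : Ordinal.{u}) (A : Set.Iio α → Set E) : Set E :=
  ⋃ β : Set.Iio α, ⋃ _ : ¬ SameParity (β : Ordinal.{u}) α,
    A β \ ⋃ γ : Set.Iio α, ⋃ _ : γ < β, A γ

/-- The class `D_α(E)`: the results of the difference operation on `α`-sequences of open sets. -/
def DiffClass (E : Type u) [TopologicalSpace E] (α : Ordinal.{u}) : Set (Set E) :=
  {S | ∃ A : Set.Iio α → Set E, (∀ β, IsOpen (A β)) ∧ S = diffOp α A}

end Classes

/-! ### Directed complete partial orders and continuous domains -/

section Domains

variable {D : Type u} [PartialOrder D]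

/-- Directed complete partial order: every nonempty directed subset has a least upper bound. -/
def IsDcpo (D : Type u) [PartialOrder D] : Prop :=
  ∀ S : Set D, S.Nonempty → DirectedOn (· ≤ ·) S → ∃ s, IsLUB S s

/-- The way-below relation `x ≪ y`. -/
def WayBelow (x y : D) : Prop :=
  ∀ (S : Set D) (s : D), S.Nonempty → DirectedOn (· ≤ ·) S → IsLUB S s → y ≤ s → ∃ z ∈ S, x ≤ z

/-- `B` is a basis of the dcpo `D` (so that `D` is a continuous domain): every `x` is the least
upper bound of the set of elements of `B` way below `x`, and this set is (nonempty and)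
directed. -/
def IsDomainBasis (B : Set D) : Prop :=
  ∀ x : D, (B ∩ {z | WayBelow z x}).Nonempty ∧
    DirectedOn (· ≤ ·) (B ∩ {z | WayBelow z x}) ∧ IsLUB (B ∩ {z | WayBelow z x}) x

end Domains

end DomainHierarchy

namespace DomainHierarchy

/-! ### Parity of ordinals -/

section Parity

/-! A set in `D_α` is coded by an ordinal index `m ≤ α` with open sublevel sets below `α`,
membership being read off the parity of `m` (`mem_diffClass_iff`). Scott-open sets are upsets, so
`m` is antitone; along an increasing alternating tree its parity flips, so it drops strictly. The
rank is thus at most `m` at the root, which is below `α` because the root lies in `A`.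

Conversely, a `Δ⁰₂` set makes "way above and on the other side of `A`" well-founded on `B`
(`IsDelta02.wellFounded`). Ranks can be truncated to any smaller ordinal
(`BTree.exists_of_le_rank`), so if no tree has rank `α`, points of `B` in `A` have rank below `α`.
Raising ranks by at most one makes their parity decide `A`; the result is antitone for `≪`, and
minimizing it over the basis elements way below `x` gives the index of `x`
(`mem_diffClass_of_antitone`). -/

theorem mod_two_eq_zero_or_one (α : Ordinal.{u}) : α % 2 = 0 ∨ α % 2 = 1 :=
  Order.le_one_iff.1 (Order.lt_succ_iff.1 (by
    simpa [one_add_one_eq_two] using Ordinal.mod_lt α (b := 2) two_ne_zero))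

theorem sameParity_of_not_of_not {α β γ : Ordinal.{u}} (h₁ : ¬ SameParity α γ)
    (h₂ : ¬ SameParity β γ) : SameParity α β := by
  unfold SameParity at *
  rcases mod_two_eq_zero_or_one α with ha | ha <;> rcases mod_two_eq_zero_or_one β with hb | hb <;>
    rcases mod_two_eq_zero_or_one γ with hc | hc <;> simp_all

theorem not_sameParity_succ (α : Ordinal.{u}) : ¬ SameParity (Order.succ α) α := by
  have hα := Ordinal.div_add_mod α 2
  unfold SameParity
  rcases mod_two_eq_zero_or_one α with h | h
  · rw [h, add_zero] at hα
    have : Order.succ α = 2 * (α / 2) + 1 := by rw [hα, Order.succ_eq_add_one]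
    rw [this, Ordinal.mul_add_mod_self, h, Ordinal.mod_eq_of_lt one_lt_two]
    exact one_ne_zero
  · rw [h] at hα
    have : Order.succ α = 2 * (α / 2 + 1) := by
      rw [mul_add, mul_one, ← one_add_one_eq_two, ← add_assoc, one_add_one_eq_two, hα,
        Order.succ_eq_add_one]
    rw [this, Ordinal.mul_mod, h]
    exact zero_ne_one

end Parity

/-! ### The difference hierarchy through index functions -/

section Classes

variable {E : Type u} [TopologicalSpace E]

/-- A set is in `D_α` if and only if membership in it is decided by the parity of an ordinal
`m x ≤ α` all of whose sublevel sets below `α` are open. -/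
theorem mem_diffClass_iff {α : Ordinal.{u}} {S : Set E} :
    S ∈ DiffClass E α ↔ ∃ m : E → Ordinal.{u}, (∀ x, m x ≤ α) ∧
      (∀ β < α, IsOpen {x | m x ≤ β}) ∧ ∀ x, x ∈ S ↔ ¬ SameParity (m x) α := by
  constructor
  · rintro ⟨A, hA, rfl⟩
    -- The index is the first `β` with `x ∈ A β`; `α` is the default for points in no `A β`, and its
    -- parity puts them outside the set.
    let I : E → Set Ordinal.{u} := fun x => {β | β = α ∨ ∃ h : β < α, x ∈ A ⟨β, h⟩}
    have hI : ∀ x, (I x).Nonempty := fun x => ⟨α, Or.inl rfl⟩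
    have hmin : ∀ x β (h : β < α), x ∈ A ⟨β, h⟩ → sInf (I x) ≤ β := fun x β h hx =>
      csInf_le' (Or.inr ⟨h, hx⟩)
    refine ⟨fun x => sInf (I x), fun x => csInf_le' (Or.inl rfl), fun β hβ => ?_, fun x => ?_⟩
    · have : {x | sInf (I x) ≤ β} = ⋃ γ : Set.Iio α, ⋃ _ : (γ : Ordinal.{u}) ≤ β, A γ := by
        ext x
        simp only [Set.mem_ofPred_eq, Set.mem_iUnion]
        constructor
        · intro hx
          rcases csInf_mem (hI x) with h | ⟨h, h'⟩
          · exact absurd (h ▸ hx) (not_le.2 hβ)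
          · exact ⟨⟨_, h⟩, hx, h'⟩
        · rintro ⟨⟨γ, hγ⟩, hγβ, hx⟩
          exact (hmin x γ hγ hx).trans hγβ
      rw [this]
      exact isOpen_iUnion fun γ => isOpen_iUnion fun _ => hA γ
    · simp only [diffOp, Set.mem_iUnion, Set.mem_sdiff, not_exists]
      constructor
      · rintro ⟨⟨β, hβ⟩, hp, hx, hlt⟩
        have : sInf (I x) = β := by
          refine le_antisymm (hmin x β hβ hx) (not_lt.1 fun h => ?_)
          rcases csInf_mem (hI x) with h' | ⟨h', h''⟩
          · exact absurd (h' ▸ h) (not_lt.2 hβ.le)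
          · exact hlt ⟨_, h'⟩ h h''
        rwa [this]
      · intro hp
        rcases csInf_mem (hI x) with h' | ⟨h', h''⟩
        · exact absurd (congrArg (· % 2) h') hp
        · exact ⟨⟨_, h'⟩, hp, h'', fun γ hγ hx => absurd (hmin x γ γ.2 hx) (not_le.2 hγ)⟩
  · rintro ⟨m, hm, ho, hS⟩
    refine ⟨fun β => {x | m x ≤ β}, fun β => ho β β.2, ?_⟩
    ext x
    rw [hS]
    simp only [diffOp, Set.mem_iUnion, Set.mem_sdiff, not_exists, Set.mem_ofPred_eq]
    constructor
    · intro hp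
      have hlt : m x < α := lt_of_le_of_ne (hm x) fun h => hp (congrArg (· % 2) h)
      exact ⟨⟨m x, hlt⟩, hp, le_rfl, fun γ hγ h => absurd h (not_le.2 hγ)⟩
    · rintro ⟨β, hp, hx, hlt⟩
      have : m x = β := le_antisymm hx <| not_lt.1 fun h =>
        hlt ⟨m x, h.trans β.2⟩ h le_rfl
      rwa [this]

end Classes

/-! ### Trees -/

section Trees

variable {X : Type u}

theorem nodeRank_eq {T : Descriptive.tree X} (hT : IsWellFoundedTree T) (σ : T) :
    nodeRank hT σ = ⨆ τ : {τ // IsSon T τ σ}, Order.succ (nodeRank hT τ.1) :=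
  (hT.wellFounded.apply σ).rank_eq

theorem nodeRank_lt_of_isSon {T : Descriptive.tree X} (hT : IsWellFoundedTree T) {σ τ : T}
    (h : IsSon T σ τ) : nodeRank hT σ < nodeRank hT τ :=
  (hT.wellFounded.apply τ).rank_lt_of_rel h

theorem nodeRank_le {T : Descriptive.tree X} (hT : IsWellFoundedTree T) (m : T → Ordinal.{u})
    (hm : ∀ σ τ, IsSon T σ τ → m σ < m τ) (σ : T) : nodeRank hT σ ≤ m σ := by
  induction σ using hT.wellFounded.induction with
  | _ σ ih =>
    rw [nodeRank_eq]
    exact Ordinal.iSup_le fun τ => Order.succ_le_of_lt ((ih _ τ.2).trans_lt (hm _ _ τ.2))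

/-- The tree of finite `R`-descending sequences which can be appended to `x`. -/
def descTree (R : X → X → Prop) (x : X) : Descriptive.tree X :=
  ⟨{l | List.IsChain (fun a b => R b a) (x :: l)}, fun l a h => by
    rw [Set.mem_ofPred_eq, ← List.cons_append] at h
    exact h.left_of_append⟩

theorem mem_descTree {R : X → X → Prop} {x : X} {l : List X} :
    l ∈ descTree R x ↔ List.IsChain (fun a b => R b a) (x :: l) := Iff.rfl

theorem nil_mem_descTree (R : X → X → Prop) (x : X) : [] ∈ descTree R x :=
  mem_descTree.2 (List.isChain_singleton _)

theorem append_singleton_mem_descTree {R : X → X → Prop} {x y : X} {l : List X} :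
    l ++ [y] ∈ descTree R x ↔ l ∈ descTree R x ∧ R y (l.getLastD x) := by
  simp only [mem_descTree]
  induction l generalizing x with
  | nil => simp
  | cons a l ih => simp only [List.cons_append, List.isChain_cons_cons, List.getLastD_cons, ih,
      and_assoc]

theorem rel_getLastD_of_isSon {R : X → X → Prop} {x : X} {σ τ : descTree R x}
    (h : IsSon (descTree R x) σ τ) : R (σ.1.getLastD x) (τ.1.getLastD x) := by
  obtain ⟨y, hy⟩ := h
  have := σ.2
  rw [hy] at this ⊢
  simpa using (append_singleton_mem_descTree.1 this).2

theorem isWellFoundedTree_descTree {R : X → X → Prop} (v : X → Ordinal.{u})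
    (hv : ∀ x y, R y x → v y < v x) (x : X) : IsWellFoundedTree (descTree R x) := by
  rintro ⟨b, hb⟩
  have hR : ∀ n, R (b (n + 1)) (b n) := fun n => by
    have h := hb (n + 1 + 1)
    rw [List.range_succ, List.map_append, List.map_singleton, append_singleton_mem_descTree,
      List.range_succ, List.map_append] at h
    simpa using h.2
  exact (wellFounded_iff_isEmpty_descending_chain.1 (wellFounded_lt (α := Ordinal.{u}))).false
    ⟨fun n => v (b n), fun n => hv _ _ (hR n)⟩

/-- The value `v` drops strictly along sons, which bounds the rank above; every smaller value is
taken by some son, which bounds it below. -/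
theorem nodeRank_descTree {R : X → X → Prop} (v : X → Ordinal.{u})
    (hv : ∀ x y, R y x → v y < v x) (hex : ∀ x, ∀ γ < v x, ∃ y, R y x ∧ v y = γ) (x : X)
    (hT : IsWellFoundedTree (descTree R x)) (σ : descTree R x) :
    nodeRank hT σ = v (σ.1.getLastD x) := by
  refine le_antisymm (nodeRank_le hT (fun σ : descTree R x => v (σ.1.getLastD x))
    (fun σ τ h => hv _ _ (rel_getLastD_of_isSon h)) σ) ?_
  induction σ using hT.wellFounded.induction with
  | _ σ ih =>
    refine le_of_forall_lt fun γ hγ => ?_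
    obtain ⟨y, hy, rfl⟩ := hex _ _ hγ
    let τ : descTree R x := ⟨σ.1 ++ [y], append_singleton_mem_descTree.2 ⟨σ.2, hy⟩⟩
    have hτ : IsSon (descTree R x) τ σ := ⟨y, rfl⟩
    have := ih τ hτ
    simp only [τ, List.getLastD_concat] at this
    exact this.trans_lt (nodeRank_lt_of_isSon hT hτ)

end Trees

namespace BTree

variable {D : Type u} {B : Set D}

theorem chi_eq_one_iff {A : Set D} {x : D} : chi A x = 1 ↔ x ∈ A := by
  by_cases h : x ∈ A <;> simp [chi, h]

theorem chi_ne_chi_iff {A : Set D} {x y : D} : chi A x ≠ chi A y ↔ ¬ (x ∈ A ↔ y ∈ A) := by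
  by_cases h : x ∈ A <;> by_cases h' : y ∈ A <;> simp [chi, h, h']

/-- If `b ∈ A` has rank at least `α` for the relation "above for `r` and separated by `A`", there
is an `r`-increasing alternating tree of rank exactly `α` with root `b`. -/
theorem exists_of_le_rank {A : Set D} {r : D → D → Prop}
    (hwf : WellFounded fun c b : B => r b c ∧ ¬ ((c : D) ∈ A ↔ (b : D) ∈ A)) {b : B}
    (hbA : (b : D) ∈ A) {α : Ordinal.{u}} (hα : α ≤ (hwf.apply b).rank) :
    ∃ t : BTree B, t.Increasing r ∧ t.Alternates A 1 ∧ t.HasRank α := by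
  -- Each node carries a budget `≤ α`, bounded by its true rank and strictly decreasing, which cuts
  -- the tree down to rank exactly `α`. Using `ToType` keeps `X` in `Type u`.
  let X : Type u := {p : B × (Order.succ α).ToType //
    (p.2.toOrd : Ordinal.{u}) ≤ (hwf.apply p.1).rank}
  let v : X → Ordinal.{u} := fun p => (p.1.2.toOrd : Ordinal.{u})
  let R : X → X → Prop := fun y x =>
    (r x.1.1 y.1.1 ∧ ¬ ((y.1.1 : D) ∈ A ↔ (x.1.1 : D) ∈ A)) ∧ v y < v x
  have hv : ∀ x y, R y x → v y < v x := fun x y h => h.2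
  have hmk : ∀ (c : B) (γ : Ordinal.{u}), γ ≤ α → γ ≤ (hwf.apply c).rank →
      ∃ x : X, x.1.1 = c ∧ v x = γ := by
    intro c γ hγ hc
    have e : ((Ordinal.ToType.mk ⟨γ, Order.lt_succ_iff.2 hγ⟩ :
      (Order.succ α).ToType).toOrd : Ordinal.{u}) = γ := by simp
    exact ⟨⟨(c, Ordinal.ToType.mk ⟨γ, Order.lt_succ_iff.2 hγ⟩), by simpa using hc⟩, rfl, e⟩
  have hex : ∀ x, ∀ γ < v x, ∃ y, R y x ∧ v y = γ := by
    intro x γ hγ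
    have hγ' := hγ.trans_le x.2
    rw [Acc.rank_eq, Ordinal.lt_iSup_iff] at hγ'
    obtain ⟨⟨c, hc⟩, hlt⟩ := hγ'
    obtain ⟨y, hy, hyγ⟩ := hmk c γ (hγ.le.trans (Order.lt_succ_iff.1 x.1.2.toOrd.2))
      (Order.lt_succ_iff.1 hlt)
    refine ⟨y, ⟨?_, by rwa [hyγ]⟩, hyγ⟩
    rw [hy]
    exact hc
  obtain ⟨x₀, hx₀, hvx₀⟩ := hmk b α le_rfl hα
  refine ⟨⟨X, descTree R x₀, nil_mem_descTree R x₀, fun σ => (σ.1.getLastD x₀).1.1⟩,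
    fun σ τ h => (rel_getLastD_of_isSon h).1.1, ⟨fun σ τ h => ?_, ?_⟩, ?_⟩
  · exact chi_ne_chi_iff.2 (rel_getLastD_of_isSon h).1.2
  · refine chi_eq_one_iff.2 ?_
    simpa [hx₀] using hbA
  · refine ⟨isWellFoundedTree_descTree v hv x₀, ?_⟩
    rw [nodeRank_descTree v hv hex]
    simpa using hvx₀

end BTree

/-! ### Domains -/

section Domains

variable {D : Type u} [PartialOrder D]

theorem WayBelow.le {x y : D} (h : WayBelow x y) : x ≤ y := by
  obtain ⟨z, rfl, hz⟩ := h {y} y (Set.singleton_nonempty y) (directedOn_singleton _)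
    isLUB_singleton le_rfl
  exact hz

theorem WayBelow.trans_le {x y z : D} (h : WayBelow x y) (hyz : y ≤ z) : WayBelow x z :=
  fun S s hne hdir hs hzs => h S s hne hdir hs (hyz.trans hzs)

theorem WayBelow.trans_le' {x y z : D} (h : WayBelow y z) (hxy : x ≤ y) : WayBelow x z :=
  fun S s hne hdir hs hzs =>
    let ⟨w, hw, hyw⟩ := h S s hne hdir hs hzs
    ⟨w, hw, hxy.trans hyw⟩

/-- Interpolation: the basis elements two `≪`-steps below `y` are directed with supremum `y`, so one
of them is above `x`. -/
theorem WayBelow.exists_between {B : Set D} (hB : IsDomainBasis B) {x y : D}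
    (h : WayBelow x y) : ∃ d ∈ B, WayBelow x d ∧ WayBelow d y := by
  let S : Set D := {c | c ∈ B ∧ ∃ d ∈ B, WayBelow c d ∧ WayBelow d y}
  have hne : S.Nonempty := by
    obtain ⟨d, hd, hdy⟩ := (hB y).1
    obtain ⟨c, hc, hcd⟩ := (hB d).1
    exact ⟨c, hc, d, hd, hcd, hdy⟩
  have hdir : DirectedOn (· ≤ ·) S := by
    rintro c₁ ⟨-, d₁, hd₁, hcd₁, hdy₁⟩ c₂ ⟨-, d₂, hd₂, hcd₂, hdy₂⟩
    obtain ⟨d, ⟨hd, hdy⟩, h₁, h₂⟩ := (hB y).2.1 d₁ ⟨hd₁, hdy₁⟩ d₂ ⟨hd₂, hdy₂⟩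
    obtain ⟨hne, hdir, hlub⟩ := hB d
    obtain ⟨e₁, he₁, hce₁⟩ := hcd₁.trans_le h₁ _ d hne hdir hlub le_rfl
    obtain ⟨e₂, he₂, hce₂⟩ := hcd₂.trans_le h₂ _ d hne hdir hlub le_rfl
    obtain ⟨e, ⟨he, hed⟩, h₁, h₂⟩ := hdir e₁ he₁ e₂ he₂
    exact ⟨e, ⟨he, d, hd, hed, hdy⟩, hce₁.trans h₁, hce₂.trans h₂⟩
  have hlub : IsLUB S y := by
    refine ⟨fun c ⟨_, d, _, hcd, hdy⟩ => hcd.le.trans hdy.le, fun u hu => ?_⟩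
    refine (hB y).2.2.2 fun d ⟨hd, hdy⟩ => ?_
    exact (hB d).2.2.2 fun c ⟨hc, hcd⟩ => hu ⟨hc, d, hd, hcd, hdy⟩
  obtain ⟨c, ⟨_, d, hd, hcd, hdy⟩, hxc⟩ := h S y hne hdir hlub le_rfl
  exact ⟨d, hd, hcd.trans_le' hxc, hdy⟩

variable [TopologicalSpace D] [Topology.IsScott D Set.univ]

theorem isOpen_setOf_wayBelow {B : Set D} (hB : IsDomainBasis B) (b : D) :
    IsOpen {x | WayBelow b x} := by
  rw [Topology.IsScott.isOpen_iff_isUpperSet_and_dirSupInaccOn (D := Set.univ)]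
  refine ⟨fun x y hxy h => WayBelow.trans_le h hxy, fun S _ hne hdir s hs hbs => ?_⟩
  obtain ⟨d, -, hbd, hds⟩ := WayBelow.exists_between hB hbs
  obtain ⟨z, hz, hdz⟩ := hds S s hne hdir hs le_rfl
  exact ⟨z, hz, hbd.trans_le hdz⟩

/-- The property is stable under complement and union, and open sets have it because they are
upsets. -/
theorem exists_isOpen_forall_le_mem_iff {S : Set D}
    (hS : S ∈ BooleanSubalgebra.closure {U : Set D | IsOpen U}) :
    ∀ x, ∃ U, IsOpen U ∧ x ∈ U ∧ ∀ y ∈ U, y ≤ x → (y ∈ S ↔ x ∈ S) := by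
  induction hS using BooleanSubalgebra.closure_bot_sup_induction with
  | mem U hU =>
    intro x
    have hup := Topology.IsScott.isUpperSet_of_isOpen (D := Set.univ) hU
    by_cases hx : x ∈ U
    · exact ⟨U, hU, hx, fun y hy _ => ⟨fun _ => hx, fun _ => hy⟩⟩
    · exact ⟨Set.univ, isOpen_univ, trivial, fun y _ hyx =>
        ⟨fun h => hup hyx h, fun h => absurd h hx⟩⟩
  | bot => exact fun x => ⟨Set.univ, isOpen_univ, trivial, fun y _ _ => Iff.rfl⟩
  | sup S _ T _ hS hT =>
    intro x
    obtain ⟨U, hU, hxU, h⟩ := hS x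
    obtain ⟨V, hV, hxV, h'⟩ := hT x
    exact ⟨U ∩ V, hU.inter hV, ⟨hxU, hxV⟩, fun y hy hyx =>
      or_congr (h y hy.1 hyx) (h' y hy.2 hyx)⟩
  | compl S _ hS =>
    intro x
    obtain ⟨U, hU, hxU, h⟩ := hS x
    exact ⟨U, hU, hxU, fun y hy hyx => not_congr (h y hy hyx)⟩

theorem IsSigma02.exists_isOpen {A : Set D} (hA : IsSigma02 A) {x : D} (hx : x ∈ A) :
    ∃ U, IsOpen U ∧ x ∈ U ∧ ∀ y ∈ U, y ≤ x → y ∈ A := by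
  obtain ⟨F, hF, rfl⟩ := hA
  obtain ⟨n, hn⟩ := Set.mem_iUnion.1 hx
  obtain ⟨U, hU, hxU, h⟩ := exists_isOpen_forall_le_mem_iff (hF n) x
  exact ⟨U, hU, hxU, fun y hy hyx => Set.mem_iUnion.2 ⟨n, (h y hy hyx).2 hn⟩⟩

theorem IsDelta02.exists_isOpen {A : Set D} (hA : IsDelta02 A) (x : D) :
    ∃ U, IsOpen U ∧ x ∈ U ∧ ∀ y ∈ U, y ≤ x → (y ∈ A ↔ x ∈ A) := by
  by_cases hx : x ∈ A
  · obtain ⟨U, hU, hxU, h⟩ := hA.1.exists_isOpen hx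
    exact ⟨U, hU, hxU, fun y hy hyx => ⟨fun _ => hx, fun _ => h y hy hyx⟩⟩
  · obtain ⟨U, hU, hxU, h⟩ := hA.2.exists_isOpen hx
    exact ⟨U, hU, hxU, fun y hy hyx => ⟨fun h' => absurd h' (h y hy hyx), fun h' => absurd h' hx⟩⟩

theorem exists_mem_inter_of_isOpen {S U : Set D} {x : D} (hU : IsOpen U) (hne : S.Nonempty)
    (hdir : DirectedOn (· ≤ ·) S) (hx : IsLUB S x) (hxU : x ∈ U) : ∃ z ∈ S, z ∈ U :=
  (Topology.IsScott.isOpen_iff_isUpperSet_and_dirSupInaccOn (D := Set.univ).1 hU).2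
    trivial hne hdir hx hxU

/-- In a dcpo there is no infinite increasing sequence which alternates between a `Δ⁰₂` set and
its complement. -/
theorem IsDelta02.wellFounded {A : Set D} (hD : IsDcpo D) (hA : IsDelta02 A) (B : Set D) :
    WellFounded fun c b : B => WayBelow (b : D) c ∧ ¬ ((c : D) ∈ A ↔ (b : D) ∈ A) := by
  rw [wellFounded_iff_isEmpty_descending_chain]
  refine ⟨fun ⟨s, hs⟩ => ?_⟩
  have hmono : Monotone fun n => (s n : D) := monotone_nat_of_le_succ fun n => (hs n).1.le
  have hdir : DirectedOn (· ≤ ·) (Set.range fun n => (s n : D)) :=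
    directedOn_range.2 hmono.directed_le
  obtain ⟨x, hx⟩ := hD _ (Set.range_nonempty _) hdir
  obtain ⟨U, hU, hxU, h⟩ := hA.exists_isOpen x
  obtain ⟨_, ⟨n, rfl⟩, hn⟩ := exists_mem_inter_of_isOpen hU (Set.range_nonempty _) hdir hx hxU
  have hup := Topology.IsScott.isUpperSet_of_isOpen (D := Set.univ) hU
  have h₁ := h _ hn (hx.1 ⟨n, rfl⟩)
  have h₂ := h _ (hup (hmono n.le_succ) hn) (hx.1 ⟨n + 1, rfl⟩)
  exact (hs n).2 (h₂.trans h₁.symm)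

theorem not_exists_bTree_of_mem_diffClass {A : Set D} {α : Ordinal.{u}} (B : Set D)
    (h : A ∈ DiffClass D α) :
    ¬ ∃ t : BTree B, t.Increasing (· ≤ ·) ∧ t.Alternates A 1 ∧ t.HasRank α := by
  obtain ⟨m, hm, ho, hS⟩ := mem_diffClass_iff.1 h
  rintro ⟨t, hinc, ⟨halt, hroot⟩, hT, hrank⟩
  have hanti : Antitone m := by
    intro x y hxy
    rcases (hm x).lt_or_eq with hlt | heq
    · exact Topology.IsScott.isUpperSet_of_isOpen (D := Set.univ) (ho _ hlt) hxy (le_refl (m x))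
    · exact heq ▸ hm y
  have hle := nodeRank_le hT (fun σ => m (t.f σ)) (fun σ τ hs => ?_) ⟨[], t.nil_mem⟩
  · rw [hrank] at hle
    exact (hS _).1 (BTree.chi_eq_one_iff.1 hroot) (congrArg (· % 2) (le_antisymm (hm _) hle))
  · refine lt_of_le_of_ne (hanti (hinc σ τ hs)) fun heq => ?_
    refine BTree.chi_ne_chi_iff.1 (halt σ τ hs) ?_
    rw [hS, hS, heq]

theorem mem_diffClass_of_antitone {B A : Set D} (hB : IsDomainBasis B) (hA : IsDelta02 A)
    {α : Ordinal.{u}} (ρ : B → Ordinal.{u}) (hρ : ∀ b c : B, WayBelow (b : D) c → ρ c ≤ ρ b)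
    (hpar : ∀ b : B, (b : D) ∈ A ↔ ¬ SameParity (ρ b) α) (hlt : ∀ b : B, (b : D) ∈ A → ρ b < α) :
    A ∈ DiffClass D α := by
  let I : D → Set Ordinal.{u} := fun x => ρ '' {b : B | WayBelow (b : D) x}
  have hI : ∀ x, (I x).Nonempty := fun x =>
    let ⟨b, hb, hbx⟩ := (hB x).1
    ⟨_, ⟨b, hb⟩, hbx, rfl⟩
  have hkey : ∀ x, ∃ d : B, ρ d = sInf (I x) ∧ ((d : D) ∈ A ↔ x ∈ A) := by
    intro x
    obtain ⟨b, hbx, hb⟩ := csInf_mem (hI x)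
    -- Interpolating yields `b ≪ d`, not merely `b ≤ d`, for any `d` above `b'`, as `hρ` requires;
    -- taking `d` also in `U` puts it on the same side of `A` as `x`.
    obtain ⟨b', hb', hbb', hb'x⟩ := WayBelow.exists_between hB hbx
    obtain ⟨U, hU, hxU, h⟩ := hA.exists_isOpen x
    obtain ⟨hne, hdir, hlub⟩ := hB x
    obtain ⟨c, hc, hcU⟩ := exists_mem_inter_of_isOpen hU hne hdir hlub hxU
    obtain ⟨d, ⟨hd, hdx⟩, h₁, h₂⟩ := hdir b' ⟨hb', hb'x⟩ c hc
    have hup := Topology.IsScott.isUpperSet_of_isOpen (D := Set.univ) hU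
    refine ⟨⟨d, hd⟩, le_antisymm ?_ (csInf_le' ⟨⟨d, hd⟩, hdx, rfl⟩), h d (hup h₂ hcU) hdx.le⟩
    rw [← hb]
    exact hρ b ⟨d, hd⟩ (hbb'.trans_le h₁)
  -- Capping at `α` is harmless: only points outside `A` can reach it, and the parity of `α` keeps
  -- them outside.
  refine mem_diffClass_iff.2 ⟨fun x => min α (sInf (I x)), fun x => min_le_left _ _,
    fun β hβ => ?_, fun x => ?_⟩
  · have : {x | min α (sInf (I x)) ≤ β} = ⋃ b : B, ⋃ _ : ρ b ≤ β, {x | WayBelow (b : D) x} := by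
      ext x
      simp only [Set.mem_ofPred_eq, Set.mem_iUnion, min_le_iff, not_le.2 hβ, false_or, exists_prop]
      constructor
      · intro h
        obtain ⟨b, hbx, hb⟩ := csInf_mem (hI x)
        exact ⟨b, hb.trans_le h, hbx⟩
      · rintro ⟨b, hb, hbx⟩
        have hmem : ρ b ∈ I x := ⟨b, hbx, rfl⟩
        exact (csInf_le' hmem).trans hb
    rw [this]
    exact isOpen_iUnion fun b => isOpen_iUnion fun _ => isOpen_setOf_wayBelow hB b
  · obtain ⟨d, hd, hdx⟩ := hkey x
    rw [← hdx]
    dsimp only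
    rw [← hd]
    constructor
    · intro h
      rw [min_eq_right (hlt d h).le]
      exact (hpar d).1 h
    · intro h
      rcases le_total α (ρ d) with h' | h'
      · rw [min_eq_left h'] at h
        exact absurd rfl h
      · rw [min_eq_right h'] at h
        exact (hpar d).2 h

theorem mem_diffClass_of_not_exists_bTree {B A : Set D} (hD : IsDcpo D) (hB : IsDomainBasis B)
    (hA : IsDelta02 A) {α : Ordinal.{u}}
    (h : ¬ ∃ t : BTree B, t.Increasing WayBelow ∧ t.Alternates A 1 ∧ t.HasRank α) :
    A ∈ DiffClass D α := by
  classical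
  have hwf := hA.wellFounded hD B
  let rk : B → Ordinal.{u} := fun b => (hwf.apply b).rank
  have hrkA : ∀ b : B, (b : D) ∈ A → rk b < α := fun b hb =>
    not_le.1 fun hle => h (BTree.exists_of_le_rank hwf hb hle)
  let good : B → Prop := fun b => ((b : D) ∈ A ↔ ¬ SameParity (rk b) α)
  let ρ : B → Ordinal.{u} := fun b => if good b then rk b else Order.succ (rk b)
  have hle : ∀ b, rk b ≤ ρ b := fun b => by
    by_cases hg : good b
    · simp [ρ, hg]
    · simp [ρ, hg]
  have hle' : ∀ b, ρ b ≤ Order.succ (rk b) := fun b => by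
    by_cases hg : good b
    · simp [ρ, hg]
    · simp [ρ, hg]
  have hpar : ∀ b : B, (b : D) ∈ A ↔ ¬ SameParity (ρ b) α := fun b => by
    by_cases hg : good b
    · simp only [ρ, if_pos hg]
      exact hg
    · simp only [ρ, if_neg hg]
      have hs := not_sameParity_succ (rk b)
      by_cases hb : (b : D) ∈ A
      · have : SameParity (rk b) α := by
          by_contra hc
          exact hg ⟨fun _ => hc, fun _ => hb⟩
        exact ⟨fun _ hc => hs (hc.trans this.symm), fun _ => hb⟩
      · have : ¬ SameParity (rk b) α := fun hc => hg ⟨fun h => absurd h hb, fun h => absurd hc h⟩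
        exact ⟨fun h => absurd h hb, fun hc => absurd (sameParity_of_not_of_not hc this) hs⟩
  refine mem_diffClass_of_antitone hB hA ρ (fun b c hbc => ?_) hpar fun b hb => ?_
  · by_cases hside : (c : D) ∈ A ↔ (b : D) ∈ A
    -- Anything way above `c` on the other side of `A` is also way above `b` and opposite to it.
    · have hrk : rk c ≤ rk b := by
        refine le_of_forall_lt fun γ hγ => ?_
        simp only [rk] at hγ
        rw [Acc.rank_eq, Ordinal.lt_iSup_iff] at hγ
        obtain ⟨⟨d, hcd, hd⟩, hlt⟩ := hγ
        refine (Order.lt_succ_iff.1 hlt).trans_lt ((hwf.apply b).rank_lt_of_rel ⟨?_, ?_⟩)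
        · exact hcd.trans_le' hbc.le
        · rwa [← hside]
      rcases hrk.lt_or_eq with hlt | heq
      · exact (hle' c).trans ((Order.succ_le_of_lt hlt).trans (hle b))
      -- Equal ranks on the same side receive the same correction.
      · have : good c ↔ good b := by simp only [good, hside, heq]
        simp only [ρ, this, heq, le_refl]
    · have hlt : rk c < rk b := (hwf.apply b).rank_lt_of_rel ⟨hbc, hside⟩
      exact (hle' c).trans ((Order.succ_le_of_lt hlt).trans (hle b))
  -- The correction could only reach `α` itself, which parity excludes for `b ∈ A`.
  · refine lt_of_le_of_ne ((hle' b).trans (Order.succ_le_of_lt (hrkA b hb))) fun heq => ?_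
    exact (hpar b).1 hb (congrArg (· % 2) heq)

end Domains

end DomainHierarchy

theorem theorem4p6 {D : Type u} [PartialOrder D] [TopologicalSpace D]
    [Topology.IsScott D Set.univ] (hD : DomainHierarchy.IsDcpo D) (B A : Set D)
    (hA : DomainHierarchy.IsDelta02 A) (α : Ordinal.{u}) (hα0 : 0 < α)
    (hα : α < Ordinal.omega 1) :
    (A ∈ DomainHierarchy.DiffClass D α →
      ¬ ∃ t : DomainHierarchy.BTree B,
        t.Increasing (· ≤ ·) ∧ t.Alternates A 1 ∧ t.HasRank α) ∧
    (DomainHierarchy.IsDomainBasis B →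
      List.TFAE [
        A ∈ DomainHierarchy.DiffClass D α,
        ¬ ∃ t : DomainHierarchy.BTree B,
          t.Increasing (· ≤ ·) ∧ t.Alternates A 1 ∧ t.HasRank α,
        ¬ ∃ t : DomainHierarchy.BTree B,
          t.Increasing DomainHierarchy.WayBelow ∧ t.Alternates A 1 ∧ t.HasRank α]) := by
  refine ⟨DomainHierarchy.not_exists_bTree_of_mem_diffClass B, fun hB => ?_⟩
  tfae_have 1 → 2 := DomainHierarchy.not_exists_bTree_of_mem_diffClass B
  tfae_have 2 → 3 := fun h ⟨t, hinc, ht⟩ => h ⟨t, fun σ τ hs => (hinc σ τ hs).le, ht⟩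
  tfae_have 3 → 1 := DomainHierarchy.mem_diffClass_of_not_exists_bTree hD hB hA
  tfae_finish
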